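/- \textbf{Setting.} There are $n$ arms $\{1,\dots,n\}$. Pulling arm $a$ draws a triple $(Y,O,M)$ from a fixed unknown law $\nu_a$, where $Y\in\mathbb{R}$ is the reward, $O\in\{0,1\}$ indicates whether $Y$ is observed, and $M$ is an auxiliary variable with values in a countable set $\mathcal{M}$; given the arm pulled, the draw is independent of the previously observed data. The agent sees $O$ and $M$, and sees $Y$ only when $O=1$. Let $\mu_a=\mathbb{E}[Y\mid A=a]$ and $\mu_{*}=\max_a\mu_a$. Assume: (i) (missing completely at random) $O$ is independent of $(A,Y,M)$, where $A$ is the pulled arm, for every law of $A$; let $\gamma=\mathbb{P}(O=1)$, which is the same for all arms; (ii) (positivity) $\mathbb{P}(O=1\mid M=m,A=a)>0$ for every arm $a$ and every $m$ with $\mathbb{P}(M=m\mid A=a)>0$; (iii) for every arm $a$, $\mu_a\in[0,1]$ and $Y$ is sub-Gaussian with variance proxy $1/4$, i.e. $\mathbb{E}[e^{\lambda(Y-\mu_a)}\mid A=a]\le e^{\lambda^2/8}$ for all $\lambda\in\mathbb{R}$ (for instance, $Y\in[0,1]$). \textbf{Algorithm.} Given $\alpha$ and the horizon $T$, in each round $t=1,\dots,T$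 the algorithm pulls an arm $a_t$ that maximizes \[ \mathrm{UCB}_a(t)=\hat\mu_a+\sqrt{\frac{\alpha\log T}{2\,T_{a,o}}}, \] where $T_{a,o}$ is the number of earlier rounds in which $a$ was pulled and its reward observed, $\hat\mu_a$ is the average of these observed rewards, and $\mathrm{UCB}_a(t)=+\infty$ if $T_{a,o}=0$. Ties are broken arbitrarily, possibly at random. \textbf{Theorem (MCAR regret guarantee).} There is a universal constant $C>0$ such that, for every such environment, every $\alpha>1$ and every $T\ge 2$, the cumulative regret $R_T=\sum_{t=1}^T(\mu_{*}-\mu_{a_t})$ of the algorithm is integrable and satisfies \[ \mathbb{E}[R_T]\le C\sqrt{\frac{\alpha\,n\,T\log T}{\gamma}} . \] -/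

import Mathlib

open MeasureTheory ProbabilityTheory

namespace MissingBandit

noncomputable section

/-- What one pull draws: the true reward `Y`, the indicator `O` that `Y` is observed, and the
(always observed) auxiliary variable `M`. -/
abbrev Draw (𝓜 : Type*) := ℝ × Bool × 𝓜

/-- The true reward `Y`. -/
def Draw.reward {𝓜 : Type*} (z : Draw 𝓜) : ℝ := z.1

/-- The indicator `O`; `true` means that the reward is observed. -/
def Draw.observed {𝓜 : Type*} (z : Draw 𝓜) : Bool := z.2.1

/-- The auxiliary variable `M`. -/
def Draw.mediator {𝓜 : Type*} (z : Draw 𝓜) : 𝓜 := z.2.2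

/-- What the agent sees of a draw: the reward is erased when it is not observed. (The number `0`
written in its place carries no information, since the indicator is recorded next to it.) -/
def Draw.visible {𝓜 : Type*} (z : Draw 𝓜) : Draw 𝓜 :=
  (if z.observed = true then z.reward else 0, z.observed, z.mediator)

/-- A bandit environment with `n` arms is a kernel `ν`: `ν a` is the law of a draw from arm `a`.
`armMean ν a` is the expected reward of arm `a`. -/
def armMean {n : ℕ} {𝓜 : Type*} [MeasurableSpace 𝓜]
    (ν : Kernel (Fin n) (Draw 𝓜)) (a : Fin n) : ℝ := ∫ z, z.reward ∂(ν a)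

/-- The largest expected reward. -/
def bestMean {n : ℕ} {𝓜 : Type*} [MeasurableSpace 𝓜]
    (ν : Kernel (Fin n) (Draw 𝓜)) : ℝ := ⨆ a, armMean ν a

/-- Positivity: given the pulled arm and any value that the auxiliary variable takes with positive
probability, the reward is observed with positive probability. -/
def Positivity {n : ℕ} {𝓜 : Type*} [MeasurableSpace 𝓜]
    (ν : Kernel (Fin n) (Draw 𝓜)) : Prop :=
  ∀ (a : Fin n) (m : 𝓜), ν a {z | z.mediator = m} ≠ 0 →
    0 < (ν a)[{z | z.observed = true} | {z | z.mediator = m}]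

/-- Missing completely at random: the indicator `O` is independent of `(A, Y, M)`, whatever the law
`ρ` of the pulled arm `A`. -/
def IsMCAR {n : ℕ} {𝓜 : Type*} [MeasurableSpace 𝓜]
    (ν : Kernel (Fin n) (Draw 𝓜)) : Prop :=
  ∀ ρ : Measure (Fin n), IsProbabilityMeasure ρ →
    IndepFun (fun p : Fin n × Draw 𝓜 => p.2.observed)
      (fun p : Fin n × Draw 𝓜 => (p.1, p.2.reward, p.2.mediator)) (ρ ⊗ₘ ν)

/-- The agent's information after `t` rounds: the arms pulled and the visible parts of the draws. -/
abbrev History (n : ℕ) (𝓜 : Type*) (t : ℕ) := Fin t → Fin n × Draw 𝓜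

/-- The rounds of a history in which arm `a` was pulled and its reward was observed. -/
def observedRounds {n : ℕ} {𝓜 : Type*} {t : ℕ} (h : History n 𝓜 t)
    (a : Fin n) : Finset (Fin t) :=
  Finset.univ.filter fun s => (h s).1 = a ∧ (h s).2.observed = true

/-- The average of the observed rewards of arm `a`. -/
def empiricalMean {n : ℕ} {𝓜 : Type*} {t : ℕ} (h : History n 𝓜 t) (a : Fin n) : ℝ :=
  (∑ s ∈ observedRounds h a, (h s).2.reward) / ((observedRounds h a).card : ℝ)

/-- The upper confidence bound of arm `a`, equal to `+∞` while no reward of `a` was observed. -/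
def ucbIndex {n : ℕ} {𝓜 : Type*} (α : ℝ) (T : ℕ) {t : ℕ} (h : History n 𝓜 t)
    (a : Fin n) : EReal :=
  if (observedRounds h a).card = 0 then ⊤
  else ((empiricalMean h a
    + √(α * Real.log (T : ℝ) / (2 * ((observedRounds h a).card : ℝ))) : ℝ) : EReal)

/-- The history before round `t` (rounds are numbered from `0`), for arms `A` and draws `Z`. -/
def historyAt {n : ℕ} {𝓜 Ω : Type*} (A : ℕ → Ω → Fin n) (Z : ℕ → Ω → Draw 𝓜)
    (t : ℕ) (ω : Ω) : History n 𝓜 t :=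
  fun s => (A s ω, (Z s ω).visible)

/-- The arms `A` and draws `Z`, random variables on a probability space `(Ω, P)`, are the first `T`
rounds of the upper confidence bound algorithm with parameter `α` and horizon `T` in the
environment `ν`. Ties may be broken in any manner, also at random. -/
structure IsUCBRun {n : ℕ} {𝓜 Ω : Type*} [MeasurableSpace 𝓜] [MeasurableSpace Ω]
    (ν : Kernel (Fin n) (Draw 𝓜)) (α : ℝ) (T : ℕ) (P : Measure Ω)
    (A : ℕ → Ω → Fin n) (Z : ℕ → Ω → Draw 𝓜) : Prop where
  /-- In each round the arm pulled has the largest upper confidence bound. -/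
  select : ∀ t < T, ∀ᵐ ω ∂P, ∀ b : Fin n,
    ucbIndex α T (historyAt A Z t ω) b ≤ ucbIndex α T (historyAt A Z t ω) (A t ω)
  /-- Given the history and the arm pulled, the draw has the law that belongs to that arm. -/
  draw : ∀ t < T, HasCondDistrib (Z t) (fun ω => (historyAt A Z t ω, A t ω))
    (ν.comap Prod.snd measurable_snd : Kernel (History n 𝓜 t × Fin n) (Draw 𝓜)) P

/-- The cumulative regret over `T` rounds. -/
def cumulativeRegret {n : ℕ} {𝓜 Ω : Type*} [MeasurableSpace 𝓜]
    (ν : Kernel (Fin n) (Draw 𝓜)) (A : ℕ → Ω → Fin n) (T : ℕ) (ω : Ω) : ℝ :=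
  ∑ t ∈ Finset.range T, (bestMean ν - armMean ν (A t ω))

end

end MissingBandit

/-!
The regret of one round is compared with confidence radii, and every expectation is taken at a fixed
round, so that neither stopping times nor a maximal inequality are needed.

Let `N` count the observed rewards of an arm before a round, and let `S` be the sum of their
deviations from the mean of the arm. Because the observation indicator is independent of the
sub-Gaussian reward, `exp (l S - l² N / 8)` is a supermartingale along a run, and its expectation is
at most `1` (`IsUCBRun.lintegral_expWeight_le_one`). The number `N` is random, and a union bound over
its values would be too weak for `α` close to `1`. Instead, a mixture of these weights over
`log₄ T + 1` geometrically spaced exponents `l` is at least `1` whenever `S ≥ √(N X / 2)`, for every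
`N ∈ [1, T]` (`one_le_sum_exp_of_sqrt_le`). So this deviation has probability at most
`(log₄ T + 1) exp (-3 X / 4)`.

If the lower bound of the best arm holds at level `X = log T` and the upper bound of the pulled arm
at level `X = 4 log T`, the choice of the arm bounds its regret by three confidence radii
(`sub_le_of_ucbIndex_le`). Since `T · T ^ (-3 / 4)` times a logarithm is of smaller order than
`√(T log T)`, the failures of the lower bound are negligible; the upper bound has to hold for all
arms, and its level makes the sum over `n ≤ T` arms negligible as well (`failure_terms_le`). If
`n > T`, the trivial bound `T` on the regret suffices.

It remains to sum the radii `1 / √(N + 1)` of the pulled arms. Given the history and the arm, the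
reward is observed with probability `γ`, so the expected sum over all rounds is `1 / γ` times the
expected sum over the rounds with an observation. The latter is at most `∑ a, 2 √(N a)` by
telescoping, where the expected sum of the final counts `N a` is `γ T`. This gives
`2 √(n γ T) / γ = 2 √(n T / γ)` (`IsUCBRun.sum_integral_inv_sqrt_card_le`).
-/

open scoped ENNReal

namespace MissingBandit

/-! ### Histories and exponential weights -/

section Histories

variable {n : ℕ} {𝓜 Ω : Type*}

lemma visible_observed (z : Draw 𝓜) : z.visible.observed = z.observed := rfl

lemma visible_reward_of_observed {z : Draw 𝓜} (hz : z.observed = true) :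
    z.visible.reward = z.reward := by
  simp [Draw.visible, Draw.reward, hz]

lemma sum_historyAt_succ {E : Type*} [AddCommMonoid E] (A : ℕ → Ω → Fin n) (Z : ℕ → Ω → Draw 𝓜)
    (t : ℕ) (ω : Ω) (f : Fin n × Draw 𝓜 → E) :
    ∑ s, f (historyAt A Z (t + 1) ω s)
      = ∑ s, f (historyAt A Z t ω s) + f (A t ω, (Z t ω).visible) := by
  rw [Fin.sum_univ_castSucc]
  rfl

/-- The sum of the deviations of the observed rewards of arm `a` from `m`. -/
def deviationSum {t : ℕ} (h : History n 𝓜 t) (a : Fin n) (m : ℝ) : ℝ :=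
  ∑ s ∈ observedRounds h a, ((h s).2.reward - m)

/-- The contribution of one round to the exponent of `expWeight`: only rounds in which arm `a` is
pulled and its reward observed count. -/
noncomputable def exponentIncrement (l m : ℝ) (a : Fin n) (p : Fin n × Draw 𝓜) : ℝ :=
  if p.1 = a ∧ p.2.observed = true then l * (p.2.reward - m) - l ^ 2 / 8 else 0

/-- The exponential weight `exp (l S - l² N / 8)`, where `S` is the deviation sum of the observed
rewards of arm `a` from `m` and `N` is their number. When `m` is the mean of arm `a` and rewards are
missing completely at random, it is a supermartingale along a run. -/
noncomputable def expWeight (l m : ℝ) (a : Fin n) {t : ℕ} (h : History n 𝓜 t) : ℝ :=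
  Real.exp (∑ s, exponentIncrement l m a (h s))

lemma expWeight_pos (l m : ℝ) (a : Fin n) {t : ℕ} (h : History n 𝓜 t) : 0 < expWeight l m a h :=
  Real.exp_pos _

lemma expWeight_historyAt_succ (l m : ℝ) (a : Fin n) (A : ℕ → Ω → Fin n) (Z : ℕ → Ω → Draw 𝓜)
    (t : ℕ) (ω : Ω) :
    expWeight l m a (historyAt A Z (t + 1) ω) = expWeight l m a (historyAt A Z t ω) *
      Real.exp (exponentIncrement l m a (A t ω, (Z t ω).visible)) := by
  unfold expWeight
  rw [← Real.exp_add, sum_historyAt_succ]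

lemma expWeight_eq (l m : ℝ) (a : Fin n) {t : ℕ} (h : History n 𝓜 t) :
    expWeight l m a h
      = Real.exp (l * deviationSum h a m - l ^ 2 * (observedRounds h a).card / 8) := by
  unfold expWeight exponentIncrement deviationSum observedRounds
  rw [← Finset.sum_filter, Finset.sum_sub_distrib, ← Finset.mul_sum, Finset.sum_const,
    nsmul_eq_mul]
  congr 1
  ring

lemma empiricalMean_sub {t : ℕ} (h : History n 𝓜 t) (a : Fin n) (m : ℝ)
    (hN : (observedRounds h a).card ≠ 0) :
    empiricalMean h a - m = deviationSum h a m / (observedRounds h a).card := by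
  have : ((observedRounds h a).card : ℝ) ≠ 0 := by exact_mod_cast hN
  unfold empiricalMean deviationSum
  rw [Finset.sum_sub_distrib, Finset.sum_const, nsmul_eq_mul]
  field_simp

lemma card_observedRounds_eq_sum {t : ℕ} (h : History n 𝓜 t) (a : Fin n) :
    (observedRounds h a).card
      = ∑ s, if (h s).1 = a ∧ (h s).2.observed = true then 1 else 0 := by
  unfold observedRounds
  rw [Finset.card_filter]

lemma card_observedRounds_succ (A : ℕ → Ω → Fin n) (Z : ℕ → Ω → Draw 𝓜)
    (t : ℕ) (ω : Ω) (a : Fin n) :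
    (observedRounds (historyAt A Z (t + 1) ω) a).card
      = (observedRounds (historyAt A Z t ω) a).card
        + if A t ω = a ∧ (Z t ω).observed = true then 1 else 0 := by
  rw [card_observedRounds_eq_sum, card_observedRounds_eq_sum]
  exact sum_historyAt_succ A Z t ω
    (fun p => if p.1 = a ∧ p.2.observed = true then 1 else 0)

lemma card_observedRounds_le {t : ℕ} (h : History n 𝓜 t) (a : Fin n) :
    (observedRounds h a).card ≤ t := by
  simpa using Finset.card_le_univ (observedRounds h a)

/-- The number of observed rewards of all arms, counted by arm and by round. -/
lemma sum_card_observedRounds (A : ℕ → Ω → Fin n) (Z : ℕ → Ω → Draw 𝓜) (T : ℕ) (ω : Ω) :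
    ∑ a, ((observedRounds (historyAt A Z T ω) a).card : ℝ)
      = ∑ t ∈ Finset.range T, if (Z t ω).observed = true then (1 : ℝ) else 0 := by
  induction T with
  | zero => simp [observedRounds]
  | succ T ih =>
    rw [Finset.sum_range_succ, ← ih]
    simp_rw [card_observedRounds_succ]
    push_cast
    rw [Finset.sum_add_distrib]
    congr 1
    by_cases h : (Z T ω).observed = true <;> simp [h]

lemma two_mul_sqrt_add_inv_sqrt_le {x : ℝ} (hx : 0 ≤ x) :
    2 * √x + 1 / √(x + 1) ≤ 2 * √(x + 1) := by
  have hq : 0 < √(x + 1) := Real.sqrt_pos.2 (by linarith)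
  have h1 : √x ^ 2 = x := Real.sq_sqrt hx
  have h2 : √(x + 1) ^ 2 = x + 1 := Real.sq_sqrt (by linarith)
  rw [← le_sub_iff_add_le', div_le_iff₀ hq]
  nlinarith [sq_nonneg (√(x + 1) - √x)]

/-- The weights `1 / √(N + 1)` of the observed pulls of an arm telescope against `2 √N`. -/
lemma sum_observed_inv_sqrt_le (A : ℕ → Ω → Fin n) (Z : ℕ → Ω → Draw 𝓜) (T : ℕ) (ω : Ω) :
    ∑ t ∈ Finset.range T, (if (Z t ω).observed = true then (1 : ℝ) else 0)
        * (1 / √((observedRounds (historyAt A Z t ω) (A t ω)).card + 1))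
      ≤ ∑ a, 2 * √((observedRounds (historyAt A Z T ω) a).card) := by
  induction T with
  | zero => exact Finset.sum_nonneg fun a _ => by positivity
  | succ T ih =>
    rw [Finset.sum_range_succ]
    refine (add_le_add_left ih _).trans ?_
    by_cases h : (Z T ω).observed = true
    · rw [if_pos h, one_mul, ← Finset.add_sum_erase _ _ (Finset.mem_univ (A T ω)),
        ← Finset.add_sum_erase (a := A T ω) _ (fun a => 2 * √(((observedRounds
          (historyAt A Z (T + 1) ω) a).card : ℝ))) (Finset.mem_univ (A T ω)), add_right_comm]
      refine add_le_add ?_ (Finset.sum_le_sum fun a _ => ?_)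
      · rw [card_observedRounds_succ, if_pos ⟨rfl, h⟩]
        push_cast
        exact two_mul_sqrt_add_inv_sqrt_le (Nat.cast_nonneg _)
      · rw [card_observedRounds_succ]
        gcongr
        simp
    · rw [if_neg h, zero_mul, add_zero]
      refine Finset.sum_le_sum fun a _ => ?_
      rw [card_observedRounds_succ]
      gcongr
      simp

end Histories

/-! ### Peeling over the sample size -/

section Analysis

/-- Peeling with the method of mixtures: the exponents `√(8 X / 4 ^ (j + 1))` are within a factor
`2` of the optimal one for every sample size `N ∈ [1, T]`, which costs a factor `3 / 4` in the
exponent of the tail bound. -/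
lemma one_le_sum_exp_of_sqrt_le {N T : ℕ} (hN : 1 ≤ N) (hNT : N ≤ T) {X s : ℝ} (hX : 0 ≤ X)
    (hs : √(N * X / 2) ≤ s) :
    1 ≤ Real.exp (-(3 / 4 * X)) * ∑ j ∈ Finset.range (Nat.log 4 T + 1),
      Real.exp (√(8 * X / 4 ^ (j + 1)) * s - √(8 * X / 4 ^ (j + 1)) ^ 2 * N / 8) := by
  set j := Nat.log 4 N with hj
  have hjT : j ∈ Finset.range (Nat.log 4 T + 1) := by
    simpa [Nat.lt_succ_iff] using Nat.log_mono_right hNT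
  have h1 : 4 ^ j ≤ N := Nat.pow_log_le_self 4 (by omega)
  have h2 : N < 4 ^ (j + 1) := Nat.lt_pow_succ_log_self (by norm_num) N
  have h1' : (4 : ℝ) ^ j ≤ N := by exact_mod_cast h1
  have h2' : (N : ℝ) < 4 ^ (j + 1) := by exact_mod_cast h2
  refine le_trans ?_ (mul_le_mul_of_nonneg_left (Finset.single_le_sum
    (f := fun j => Real.exp (√(8 * X / 4 ^ (j + 1)) * s - √(8 * X / 4 ^ (j + 1)) ^ 2 * N / 8))
    (fun i _ => (Real.exp_pos _).le) hjT) (Real.exp_pos _).le)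
  rw [← Real.exp_add, Real.one_le_exp_iff]
  set D : ℝ := 4 ^ (j + 1) with hD
  have hD0 : 0 < D := by positivity
  -- with `u = √(N / D) ∈ [1 / 2, 1]`, the exponent is at least `X (2 u - u ^ 2) ≥ 3 X / 4`
  set u := √(N / D) with hu
  have hu2 : u ^ 2 = N / D := Real.sq_sqrt (by positivity)
  have hu0 : 0 ≤ u := Real.sqrt_nonneg _
  have hu1 : u ≤ 1 := by
    exact Real.sqrt_le_one.2 ((div_le_one hD0).2 h2'.le)
  have hu3 : 1 / 2 ≤ u := by
    refine Real.le_sqrt_of_sq_le ?_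
    rw [le_div_iff₀ hD0, hD, pow_succ (4 : ℝ)]
    linarith
  have hprod : √(8 * X / D) * √(N * X / 2) = 2 * X * u := by
    rw [← Real.sqrt_mul (by positivity), hu,
      show 8 * X / D * (N * X / 2) = (2 * X) ^ 2 * (N / D) by field_simp; ring,
      Real.sqrt_mul (by positivity), Real.sqrt_sq (by positivity)]
  have hsq : √(8 * X / D) ^ 2 * N / 8 = X * u ^ 2 := by
    rw [Real.sq_sqrt (by positivity), hu2]; field_simp
  have hm := mul_le_mul_of_nonneg_left hs (Real.sqrt_nonneg (8 * X / D))
  rw [hprod] at hm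
  rw [hsq]
  nlinarith [mul_nonneg hX (mul_nonneg (sub_nonneg.2 hu3) (show 0 ≤ 3 / 2 - u by linarith))]

end Analysis

/-! ### Measurability -/

section Measurability

variable {n : ℕ} {𝓜 : Type*} [MeasurableSpace 𝓜]

@[fun_prop]
lemma measurable_reward : Measurable (Draw.reward : Draw 𝓜 → ℝ) := measurable_fst

@[fun_prop]
lemma measurable_observed : Measurable (Draw.observed : Draw 𝓜 → Bool) :=
  measurable_fst.comp measurable_snd

lemma measurableSet_observed : MeasurableSet {z : Draw 𝓜 | z.observed = true} :=
  measurable_observed (measurableSet_singleton true)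

@[fun_prop]
lemma measurable_visible : Measurable (Draw.visible : Draw 𝓜 → Draw 𝓜) :=
  (Measurable.ite measurableSet_observed measurable_reward measurable_const).prodMk
    measurable_snd

lemma measurableSet_pulled_observed (a : Fin n) :
    MeasurableSet {p : Fin n × Draw 𝓜 | p.1 = a ∧ p.2.observed = true} :=
  (measurable_fst (measurableSet_singleton a)).inter (measurable_snd measurableSet_observed)

@[fun_prop]
lemma measurable_exponentIncrement (l m : ℝ) (a : Fin n) :
    Measurable (exponentIncrement l m a : Fin n × Draw 𝓜 → ℝ) :=
  Measurable.ite (measurableSet_pulled_observed a) (by fun_prop) measurable_const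

@[fun_prop]
lemma measurable_expWeight (l m : ℝ) (a : Fin n) (t : ℕ) :
    Measurable (expWeight l m a : History n 𝓜 t → ℝ) := by
  unfold expWeight
  fun_prop

@[fun_prop]
lemma measurable_card_observedRounds (a : Fin n) (t : ℕ) :
    Measurable fun h : History n 𝓜 t => (observedRounds h a).card := by
  simp_rw [card_observedRounds_eq_sum]
  refine Finset.measurable_sum _ fun s _ => ?_
  exact (Measurable.ite (measurableSet_pulled_observed a) measurable_const
    measurable_const).comp (measurable_pi_apply s)

end Measurability

/-! ### One draw from the environment -/

section Environment

variable {n : ℕ} {𝓜 : Type*} [MeasurableSpace 𝓜] {ν : Kernel (Fin n) (Draw 𝓜)}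
  [IsMarkovKernel ν]

lemma IsMCAR.indepFun_reward (h : IsMCAR ν) (a : Fin n) :
    IndepFun (Draw.observed : Draw 𝓜 → Bool) Draw.reward (ν a) := by
  have h1 := (h (Measure.dirac a) inferInstance).comp (φ := id)
    (ψ := fun q : Fin n × ℝ × 𝓜 => q.2.1) measurable_id (by fun_prop)
  have h2 : Measure.dirac a ⊗ₘ ν = (ν a).map (Prod.mk a) := by
    ext s hs
    rw [Measure.dirac_compProd_apply hs, Measure.map_apply measurable_prodMk_left hs]
  rw [h2] at h1
  rw [indepFun_iff_measure_inter_preimage_eq_mul] at h1 ⊢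
  intro s t hs ht
  have h3 := h1 s t hs ht
  have hA : MeasurableSet ((id ∘ fun p : Fin n × Draw 𝓜 => p.2.observed) ⁻¹' s) :=
    (measurable_observed.comp measurable_snd) hs
  have hB : MeasurableSet (((fun q : Fin n × ℝ × 𝓜 => q.2.1) ∘
      fun p : Fin n × Draw 𝓜 => (p.1, p.2.reward, p.2.mediator)) ⁻¹' t) :=
    (measurable_reward.comp measurable_snd) ht
  rw [Measure.map_apply measurable_prodMk_left (hA.inter hB),
    Measure.map_apply measurable_prodMk_left hA, Measure.map_apply measurable_prodMk_left hB] at h3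
  exact h3

/-- Since the auxiliary variable takes countably many values, positivity yields a positive
observation probability. -/
lemma Positivity.observed_ne_zero [Countable 𝓜] (h : Positivity ν) (a : Fin n) :
    ν a {z | z.observed = true} ≠ 0 := by
  obtain ⟨m, hm⟩ : ∃ m, ν a {z | z.mediator = m} ≠ 0 := by
    by_contra! hc
    have : ν a (⋃ m, {z : Draw 𝓜 | z.mediator = m}) = 0 := measure_iUnion_null hc
    rw [Set.iUnion_eq_univ_iff.2 fun z => ⟨z.mediator, rfl⟩, measure_univ] at this
    exact one_ne_zero this
  intro h0
  exact (h a m hm).ne' (cond_absolutelyContinuous h0)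

/-- One factor of `expWeight` has expectation at most `1`, because the observation indicator is
independent of the sub-Gaussian reward. -/
lemma lintegral_exp_exponentIncrement_le_one (h : IsMCAR ν) {a : Fin n}
    (hsg : HasSubgaussianMGF (fun z : Draw 𝓜 => z.reward - armMean ν a) (1 / 4) (ν a))
    (l : ℝ) (b : Fin n) :
    ∫⁻ z, ENNReal.ofReal (Real.exp (exponentIncrement l (armMean ν a) a (b, z.visible))) ∂(ν b)
      ≤ 1 := by
  by_cases hb : b = a
  · subst hb
    set f : Draw 𝓜 → ℝ≥0∞ := fun z =>
      ENNReal.ofReal (Real.exp (l * (z.reward - armMean ν b) - l ^ 2 / 8)) with hf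
    set o : Draw 𝓜 → ℝ≥0∞ := {z | z.observed = true}.indicator 1 with ho
    have hom : Measurable o := measurable_one.indicator measurableSet_observed
    have hfm : Measurable f := by fun_prop
    have hind : IndepFun o f (ν b) := by
      have := (h.indepFun_reward b).comp (φ := fun x => if x = true then (1 : ℝ≥0∞) else 0)
        (ψ := fun y => ENNReal.ofReal (Real.exp (l * (y - armMean ν b) - l ^ 2 / 8)))
        (measurable_of_finite _) (by fun_prop)
      convert this using 1
      · ext z
        simp [ho, Set.indicator_apply]
      · rfl
    have hf1 : ∫⁻ z, f z ∂(ν b) ≤ 1 := by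
      have h1 : Integrable (fun z : Draw 𝓜 =>
          Real.exp (l * (z.reward - armMean ν b) - l ^ 2 / 8)) (ν b) := by
        simp_rw [Real.exp_sub]
        exact (hsg.integrable_exp_mul l).div_const _
      rw [hf, ← ofReal_integral_eq_lintegral_ofReal h1 (ae_of_all _ fun _ => (Real.exp_pos _).le)]
      rw [ENNReal.ofReal_le_one]
      simp_rw [Real.exp_sub]
      rw [integral_div, div_le_one (Real.exp_pos _)]
      refine (hsg.mgf_le l).trans (Real.exp_le_exp.2 (le_of_eq ?_))
      push_cast
      ring
    have hpt : ∀ z : Draw 𝓜, ENNReal.ofReal (Real.exp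
        (exponentIncrement l (armMean ν b) b (b, z.visible)))
        = {z | z.observed = true}ᶜ.indicator 1 z + (o * f) z := by
      intro z
      by_cases hz : z.observed = true
      · simp [exponentIncrement, visible_observed, visible_reward_of_observed hz, ho, hf, hz]
      · simp [exponentIncrement, visible_observed, ho, hz]
    simp_rw [hpt]
    rw [lintegral_add_right _ (hom.mul hfm),
      lintegral_mul_eq_lintegral_mul_lintegral_of_indepFun hom hfm hind,
      lintegral_indicator_one measurableSet_observed.compl, ho,
      lintegral_indicator_one measurableSet_observed]
    calc _ ≤ ν b {z | z.observed = true}ᶜ + ν b {z | z.observed = true} * 1 := by gcongr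
      _ = 1 := by rw [mul_one, add_comm, measure_add_measure_compl measurableSet_observed,
                    measure_univ]
  · simp [exponentIncrement, hb]

end Environment

/-! ### Integrating out one round of a run -/

section Run

variable {n : ℕ} {𝓜 Ω : Type*} [MeasurableSpace 𝓜] [MeasurableSpace Ω]
  {ν : Kernel (Fin n) (Draw 𝓜)} {α : ℝ} {T : ℕ} {P : Measure Ω}
  {A : ℕ → Ω → Fin n} {Z : ℕ → Ω → Draw 𝓜}

lemma IsUCBRun.aemeasurable_historyAt (hr : IsUCBRun ν α T P A Z) {t : ℕ} (ht : t < T) :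
    AEMeasurable (historyAt A Z t) P :=
  measurable_fst.comp_aemeasurable (hr.draw t ht).aemeasurable_fst

lemma IsUCBRun.aemeasurable_arm (hr : IsUCBRun ν α T P A Z) {t : ℕ} (ht : t < T) :
    AEMeasurable (A t) P :=
  measurable_snd.comp_aemeasurable (hr.draw t ht).aemeasurable_fst

lemma IsUCBRun.aemeasurable_draw (hr : IsUCBRun ν α T P A Z) {t : ℕ} (ht : t < T) :
    AEMeasurable (Z t) P :=
  (hr.draw t ht).aemeasurable_snd

variable [IsMarkovKernel ν] [IsProbabilityMeasure P]

/-- The draw of a round can be integrated out given the history and the arm pulled. -/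
lemma IsUCBRun.lintegral_eq (hr : IsUCBRun ν α T P A Z) {t : ℕ} (ht : t < T)
    {F : (History n 𝓜 t × Fin n) × Draw 𝓜 → ℝ≥0∞} (hF : Measurable F) :
    ∫⁻ ω, F ((historyAt A Z t ω, A t ω), Z t ω) ∂P
      = ∫⁻ ω, ∫⁻ z, F ((historyAt A Z t ω, A t ω), z) ∂(ν (A t ω)) ∂P := by
  have h := hr.draw t ht
  have hl : HasLaw _ _ P := h
  have : IsProbabilityMeasure (P.map fun ω => (historyAt A Z t ω, A t ω)) :=
    Measure.isProbabilityMeasure_map h.aemeasurable_fst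
  rw [← lintegral_map' (f := F) (g := fun ω => ((historyAt A Z t ω, A t ω), Z t ω))
    hF.aemeasurable hl.aemeasurable, hl.map_eq, Measure.lintegral_compProd hF,
    lintegral_map' hF.lintegral_kernel_prod_right'.aemeasurable h.aemeasurable_fst]
  rfl

/-- The exponential weights of a run have expectation at most `1`. -/
lemma IsUCBRun.lintegral_expWeight_le_one (hr : IsUCBRun ν α T P A Z) (hm : IsMCAR ν) {a : Fin n}
    (hsg : HasSubgaussianMGF (fun z : Draw 𝓜 => z.reward - armMean ν a) (1 / 4) (ν a))
    (l : ℝ) {t : ℕ} (ht : t ≤ T) :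
    ∫⁻ ω, ENNReal.ofReal (expWeight l (armMean ν a) a (historyAt A Z t ω)) ∂P ≤ 1 := by
  induction t with
  | zero => simp [expWeight]
  | succ t ih =>
    refine le_trans ?_ (ih (by omega))
    have hF : Measurable fun q : (History n 𝓜 t × Fin n) × Draw 𝓜 =>
        ENNReal.ofReal (expWeight l (armMean ν a) a q.1.1) *
          ENNReal.ofReal (Real.exp (exponentIncrement l (armMean ν a) a (q.1.2, q.2.visible))) := by
      fun_prop
    have h1 := hr.lintegral_eq (by omega) hF
    have h2 : ∀ ω, ENNReal.ofReal (expWeight l (armMean ν a) a (historyAt A Z (t + 1) ω))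
        = ENNReal.ofReal (expWeight l (armMean ν a) a (historyAt A Z t ω)) *
          ENNReal.ofReal (Real.exp
            (exponentIncrement l (armMean ν a) a (A t ω, (Z t ω).visible))) := by
      intro ω
      rw [← ENNReal.ofReal_mul (expWeight_pos ..).le, expWeight_historyAt_succ]
    simp_rw [h2]
    rw [h1]
    refine lintegral_mono fun ω => ?_
    dsimp only
    rw [lintegral_const_mul _ (by fun_prop)]
    exact mul_le_of_le_one_right' (lintegral_exp_exponentIncrement_le_one hm hsg l _)

lemma IsUCBRun.integrable_expWeight (hr : IsUCBRun ν α T P A Z) (hm : IsMCAR ν) {a : Fin n}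
    (hsg : HasSubgaussianMGF (fun z : Draw 𝓜 => z.reward - armMean ν a) (1 / 4) (ν a))
    (l : ℝ) {t : ℕ} (ht : t < T) :
    Integrable (fun ω => expWeight l (armMean ν a) a (historyAt A Z t ω)) P := by
  refine ⟨((measurable_expWeight l _ a t).comp_aemeasurable
    (hr.aemeasurable_historyAt ht)).aestronglyMeasurable, ?_⟩
  rw [hasFiniteIntegral_iff_ofReal (ae_of_all _ fun _ => (expWeight_pos ..).le)]
  exact (hr.lintegral_expWeight_le_one hm hsg l ht.le).trans_lt ENNReal.one_lt_top

lemma IsUCBRun.integral_expWeight_le_one (hr : IsUCBRun ν α T P A Z) (hm : IsMCAR ν) {a : Fin n}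
    (hsg : HasSubgaussianMGF (fun z : Draw 𝓜 => z.reward - armMean ν a) (1 / 4) (ν a))
    (l : ℝ) {t : ℕ} (ht : t < T) :
    ∫ ω, expWeight l (armMean ν a) a (historyAt A Z t ω) ∂P ≤ 1 := by
  rw [integral_eq_lintegral_of_nonneg_ae (ae_of_all _ fun _ => (expWeight_pos ..).le)
    (hr.integrable_expWeight hm hsg l ht).aestronglyMeasurable]
  exact ENNReal.toReal_le_of_le_ofReal zero_le_one
    (by simpa using hr.lintegral_expWeight_le_one hm hsg l ht.le)

/-- The reward of a round is observed with probability `γ`, independently of everything that is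
determined by the history and the arm pulled. -/
lemma IsUCBRun.integral_observed_mul (hr : IsUCBRun ν α T P A Z) {γ : ℝ}
    (hγ : ∀ a, (ν a).real {z | z.observed = true} = γ) {t : ℕ} (ht : t < T)
    {g : History n 𝓜 t × Fin n → ℝ} (hg : Measurable g) (hg0 : ∀ x, 0 ≤ g x) :
    ∫ ω, (if (Z t ω).observed = true then (1 : ℝ) else 0) * g (historyAt A Z t ω, A t ω) ∂P
      = γ * ∫ ω, g (historyAt A Z t ω, A t ω) ∂P := by
  have hom : Measurable fun z : Draw 𝓜 => if z.observed = true then (1 : ℝ) else 0 :=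
    Measurable.ite measurableSet_observed measurable_const measurable_const
  have hX := (hr.draw t ht).aemeasurable_fst
  have hF : Measurable fun q : (History n 𝓜 t × Fin n) × Draw 𝓜 =>
      ENNReal.ofReal (g q.1) * ENNReal.ofReal (if q.2.observed = true then (1 : ℝ) else 0) := by
    exact (by fun_prop : Measurable fun q : (History n 𝓜 t × Fin n) × Draw 𝓜 =>
      ENNReal.ofReal (g q.1)).mul (hom.ennreal_ofReal.comp measurable_snd)
  have h1 := hr.lintegral_eq ht hF
  have h2 : ∀ b, ∫⁻ z, ENNReal.ofReal (if z.observed = true then (1 : ℝ) else 0) ∂(ν b)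
      = ENNReal.ofReal γ := by
    intro b
    rw [← hγ b, ofReal_measureReal, ← lintegral_indicator_one measurableSet_observed]
    congr 1
    ext z
    by_cases hz : z.observed = true <;> simp [hz]
  have hγ0 (b : Fin n) : 0 ≤ γ := hγ b ▸ measureReal_nonneg
  obtain ⟨ω₀⟩ : Nonempty Ω := P.nonempty_of_neZero
  have h3 (ω : Ω) : ∫⁻ z, ENNReal.ofReal (g (historyAt A Z t ω, A t ω)) *
      ENNReal.ofReal (if z.observed = true then (1 : ℝ) else 0) ∂(ν (A t ω))
      = ENNReal.ofReal γ * ENNReal.ofReal (g (historyAt A Z t ω, A t ω)) := by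
    rw [lintegral_const_mul _ hom.ennreal_ofReal, h2, mul_comm]
  simp_rw [h3] at h1
  rw [lintegral_const_mul' _ _ ENNReal.ofReal_ne_top] at h1
  rw [integral_eq_lintegral_of_nonneg_ae, integral_eq_lintegral_of_nonneg_ae,
    ← ENNReal.toReal_ofReal (hγ0 (A t ω₀)), ← ENNReal.toReal_mul, ← h1]
  · congr 1
    refine lintegral_congr fun ω => ?_
    rw [mul_comm, ENNReal.ofReal_mul (hg0 _)]
  · exact ae_of_all _ fun ω => hg0 _
  · exact (hg.comp_aemeasurable hX).aestronglyMeasurable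
  · exact ae_of_all _ fun ω => mul_nonneg (by positivity) (hg0 _)
  · exact ((hom.comp_aemeasurable (hr.aemeasurable_draw ht)).mul
      (hg.comp_aemeasurable hX)).aestronglyMeasurable

end Run

/-! ### The regret of one round -/

section TailMixture

variable {n : ℕ} {𝓜 : Type*}

/-- A mixture of exponential weights that is at least `1` when the deviation sum `S` of arm `a`
satisfies `e S ≥ √(N X / 2)`; the sign `e = ± 1` selects the upper or the lower tail. -/
noncomputable def tailMixture (e X : ℝ) (T : ℕ) (m : ℝ) (a : Fin n) {t : ℕ}
    (h : History n 𝓜 t) : ℝ :=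
  Real.exp (-(3 / 4 * X)) * ∑ j ∈ Finset.range (Nat.log 4 T + 1),
    expWeight (e * √(8 * X / 4 ^ (j + 1))) m a h

lemma tailMixture_nonneg (e X : ℝ) (T : ℕ) (m : ℝ) (a : Fin n) {t : ℕ} (h : History n 𝓜 t) :
    0 ≤ tailMixture e X T m a h :=
  mul_nonneg (Real.exp_pos _).le (Finset.sum_nonneg fun _ _ => (expWeight_pos ..).le)

lemma one_le_tailMixture {e X : ℝ} (he : e ^ 2 = 1) (hX : 0 ≤ X) {t T : ℕ} (ht : t ≤ T) {m : ℝ}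
    {a : Fin n} {h : History n 𝓜 t} (hN : (observedRounds h a).card ≠ 0)
    (hs : √((observedRounds h a).card * X / 2) ≤ e * deviationSum h a m) :
    1 ≤ tailMixture e X T m a h := by
  refine (one_le_sum_exp_of_sqrt_le (Nat.one_le_iff_ne_zero.2 hN)
    ((card_observedRounds_le h a).trans ht) hX hs).trans_eq ?_
  unfold tailMixture
  congr 1
  refine Finset.sum_congr rfl fun j _ => ?_
  rw [expWeight_eq, mul_pow, he]
  ring_nf

lemma log_two_le_mul_log {α : ℝ} (hα : 1 < α) {T : ℕ} (hT : 2 ≤ T) :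
    Real.log 2 ≤ Real.log T ∧ Real.log T ≤ α * Real.log T := by
  have h1 : Real.log 2 ≤ Real.log T := Real.log_le_log (by norm_num) (by exact_mod_cast hT)
  have h2 : 0 < Real.log 2 := Real.log_pos (by norm_num)
  exact ⟨h1, by nlinarith⟩

lemma sqrt_mul_div_self {N X : ℝ} (hN : 0 < N) (hX : 0 ≤ X) :
    √(N * X / 2) / N = √(X / (2 * N)) := by
  rw [div_eq_iff hN.ne', ← Real.sqrt_sq hN.le, ← Real.sqrt_mul (by positivity),
    Real.sqrt_sq hN.le]
  congr 1
  field_simp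

/-- The regret of one round: either one of the confidence bounds fails, which makes a tail mixture
at least `1`, or the regret is at most three confidence radii of the arm pulled. The upper tails are
taken at the level `4 log T`, which leaves room for summing over all arms; the lower tail is needed
for the best arm `a` only. -/
lemma sub_le_of_ucbIndex_le {α : ℝ} (hα : 1 < α) {t T : ℕ} (hT : 2 ≤ T) (ht : t ≤ T)
    {m : Fin n → ℝ} (hm : ∀ a, m a ∈ Set.Icc (0 : ℝ) 1) {a b : Fin n} {h : History n 𝓜 t}
    (hab : ucbIndex α T h a ≤ ucbIndex α T h b) :
    m a - m b ≤ 3 * √(α * Real.log T) * (1 / √((observedRounds h b).card + 1))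
      + tailMixture (-1) (Real.log T) T (m a) a h
      + ∑ c, tailMixture 1 (4 * Real.log T) T (m c) c h := by
  obtain ⟨hL2, hLα⟩ := log_two_le_mul_log hα hT
  set L := Real.log T
  have hlog2 : 0.69 < Real.log 2 := by linarith [Real.log_two_gt_d9]
  have hL : 0 < L := by linarith
  have h1 : m a - m b ≤ 1 := by linarith [(hm a).2, (hm b).1]
  have ht1 : 0 ≤ 3 * √(α * L) * (1 / √((observedRounds h b).card + 1)) := by positivity
  have ht2 := tailMixture_nonneg (-1) L T (m a) a h
  have ht3' : ∀ c ∈ Finset.univ, 0 ≤ tailMixture 1 (4 * L) T (m c) c h :=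
    fun c _ => tailMixture_nonneg ..
  have ht3 := Finset.sum_nonneg ht3'
  have hb1 := Finset.single_le_sum ht3' (Finset.mem_univ b)
  -- an arm without observations is charged the full regret bound `1`
  by_cases hNb : (observedRounds h b).card = 0
  · have : 1 ≤ 3 * √(α * L) := by
      have : 1 / 3 ≤ √(α * L) := Real.le_sqrt_of_sq_le (by linarith)
      linarith
    simp only [hNb, Nat.cast_zero, zero_add, Real.sqrt_one, div_one, mul_one] at ht1 ⊢
    linarith
  -- otherwise the index of `b` is finite, hence so is that of `a`
  have hNa : (observedRounds h a).card ≠ 0 := by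
    intro h0
    simp only [ucbIndex, h0, hNb, if_true, if_false, top_le_iff] at hab
    exact EReal.coe_ne_top _ hab
  simp only [ucbIndex, hNa, hNb, if_false, EReal.coe_le_coe_iff] at hab
  by_cases hA : √((observedRounds h a).card * L / 2) ≤ -1 * deviationSum h a (m a)
  · linarith [one_le_tailMixture (by norm_num) hL.le ht hNa hA]
  by_cases hB : √((observedRounds h b).card * (4 * L) / 2) ≤ 1 * deviationSum h b (m b)
  · linarith [one_le_tailMixture (by norm_num) (by positivity) ht hNb hB]
  push Not at hA hB
  have hda := empiricalMean_sub h a (m a) hNa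
  have hdb := empiricalMean_sub h b (m b) hNb
  have hNa' : (0 : ℝ) < (observedRounds h a).card := by exact_mod_cast Nat.pos_of_ne_zero hNa
  have hNb' : (1 : ℝ) ≤ (observedRounds h b).card := by
    exact_mod_cast Nat.one_le_iff_ne_zero.2 hNb
  generalize ((observedRounds h a).card : ℝ) = x at *
  generalize ((observedRounds h b).card : ℝ) = y at *
  have hy : 0 < y := by linarith
  have hra : -(√(α * L / (2 * x))) ≤ empiricalMean h a - m a := by
    have : -(√(x * L / 2) / x) ≤ deviationSum h a (m a) / x := by
      rw [← neg_div]
      gcongr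
      linarith
    rw [sqrt_mul_div_self hNa' hL.le] at this
    rw [hda]
    refine le_trans (neg_le_neg (Real.sqrt_le_sqrt ?_)) this
    gcongr
  have hrb : empiricalMean h b - m b ≤ 2 * √(α * L / (2 * y)) := by
    have : deviationSum h b (m b) / y ≤ √(y * (4 * L) / 2) / y := by
      gcongr
      linarith
    rw [sqrt_mul_div_self hy (by positivity)] at this
    rw [hdb]
    refine this.trans ?_
    rw [show 4 * L / (2 * y) = 2 ^ 2 * (L / (2 * y)) by ring, Real.sqrt_mul (by positivity),
      Real.sqrt_sq (by norm_num)]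
    gcongr
  have hr : √(α * L / (2 * y)) ≤ √(α * L) * (1 / √(y + 1)) := by
    rw [mul_one_div, ← Real.sqrt_div (by positivity)]
    refine Real.sqrt_le_sqrt (div_le_div_of_nonneg_left (by positivity) (by positivity) ?_)
    linarith
  linarith

lemma inv_sqrt_card_mem_Icc {t : ℕ} (h : History n 𝓜 t) (a : Fin n) :
    1 / √((observedRounds h a).card + 1) ∈ Set.Icc (0 : ℝ) 1 := by
  refine ⟨by positivity, ?_⟩
  rw [div_le_one (by positivity), Real.one_le_sqrt]
  linarith [(Nat.cast_nonneg _ : (0 : ℝ) ≤ ((observedRounds h a).card : ℝ))]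

end TailMixture

/-! ### Expected confidence widths and failures -/

section Expectations

variable {n : ℕ} {𝓜 Ω : Type*} [MeasurableSpace 𝓜] [MeasurableSpace Ω]
  {ν : Kernel (Fin n) (Draw 𝓜)} {α : ℝ} {T : ℕ} {P : Measure Ω} [IsProbabilityMeasure P]
  {A : ℕ → Ω → Fin n} {Z : ℕ → Ω → Draw 𝓜}

lemma measurable_inv_sqrt_card (t : ℕ) :
    Measurable fun x : History n 𝓜 t × Fin n => 1 / √((observedRounds x.1 x.2).card + 1) := by
  refine measurable_from_prod_countable_left fun a => ?_
  have := measurable_card_observedRounds (𝓜 := 𝓜) a t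
  fun_prop

lemma integrable_of_mem_Icc {f : Ω → ℝ} (hf : AEMeasurable f P)
    (h : ∀ ω, f ω ∈ Set.Icc (0 : ℝ) 1) : Integrable f P :=
  (integrable_const (1 : ℝ)).mono' hf.aestronglyMeasurable
    (ae_of_all _ fun ω => by rw [Real.norm_of_nonneg (h ω).1]; exact (h ω).2)

lemma IsUCBRun.integrable_inv_sqrt_card (hr : IsUCBRun ν α T P A Z) {t : ℕ} (ht : t < T) :
    Integrable (fun ω => 1 / √((observedRounds (historyAt A Z t ω) (A t ω)).card + 1)) P := by
  have hX := (hr.draw t ht).aemeasurable_fst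
  have h := (measurable_inv_sqrt_card (n := n) (𝓜 := 𝓜) t).comp_aemeasurable hX
  refine integrable_of_mem_Icc ?_ ?_
  · exact h
  · intro ω
    exact inv_sqrt_card_mem_Icc (historyAt A Z t ω) (A t ω)

variable [IsMarkovKernel ν]

lemma IsUCBRun.integrable_tailMixture (hr : IsUCBRun ν α T P A Z) (hm : IsMCAR ν) {a : Fin n}
    (hsg : HasSubgaussianMGF (fun z : Draw 𝓜 => z.reward - armMean ν a) (1 / 4) (ν a))
    (e X : ℝ) {t : ℕ} (ht : t < T) :
    Integrable (fun ω => tailMixture e X T (armMean ν a) a (historyAt A Z t ω)) P :=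
  (integrable_finsetSum _ fun _ _ => hr.integrable_expWeight hm hsg _ ht).const_mul _

lemma IsUCBRun.integral_tailMixture_le (hr : IsUCBRun ν α T P A Z) (hm : IsMCAR ν) {a : Fin n}
    (hsg : HasSubgaussianMGF (fun z : Draw 𝓜 => z.reward - armMean ν a) (1 / 4) (ν a))
    (e X : ℝ) {t : ℕ} (ht : t < T) :
    ∫ ω, tailMixture e X T (armMean ν a) a (historyAt A Z t ω) ∂P
      ≤ Real.exp (-(3 / 4 * X)) * (Nat.log 4 T + 1) := by
  unfold tailMixture
  rw [integral_const_mul, integral_finsetSum _ fun _ _ => hr.integrable_expWeight hm hsg _ ht]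
  gcongr
  refine (Finset.sum_le_sum fun j _ => hr.integral_expWeight_le_one hm hsg _ ht).trans_eq ?_
  simp

/-- The expected sum of the confidence widths. Every pull is observed with probability `γ`, so it
is `1 / γ` times the expected sum over observed pulls; the latter telescopes to `∑ a, 2 √(N a)`,
where the expected total number of observations is `γ T`. -/
lemma IsUCBRun.sum_integral_inv_sqrt_card_le (hr : IsUCBRun ν α T P A Z) {γ : ℝ} (hγ0 : 0 < γ)
    (hγ : ∀ a, (ν a).real {z | z.observed = true} = γ) (hn : 0 < n) (hT : 0 < T) :
    ∑ t ∈ Finset.range T,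
      ∫ ω, 1 / √((observedRounds (historyAt A Z t ω) (A t ω)).card + 1) ∂P
      ≤ 2 * √(n * T / γ) := by
  have hom : Measurable fun z : Draw 𝓜 => if z.observed = true then (1 : ℝ) else 0 :=
    Measurable.ite measurableSet_observed measurable_const measurable_const
  have hO {t : ℕ} (ht : t ∈ Finset.range T) :
      Integrable (fun ω => if (Z t ω).observed = true then (1 : ℝ) else 0) P :=
    integrable_of_mem_Icc
      (hom.comp_aemeasurable (hr.aemeasurable_draw (Finset.mem_range.1 ht)))
      fun ω => by split_ifs <;> simp
  have hOw {t : ℕ} (ht : t ∈ Finset.range T) :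
      Integrable (fun ω => (if (Z t ω).observed = true then (1 : ℝ) else 0) *
        (1 / √((observedRounds (historyAt A Z t ω) (A t ω)).card + 1))) P := by
    refine integrable_of_mem_Icc ((hO ht).aemeasurable.mul
      (hr.integrable_inv_sqrt_card (Finset.mem_range.1 ht)).aemeasurable) fun ω => ?_
    have := inv_sqrt_card_mem_Icc (historyAt A Z t ω) (A t ω)
    split_ifs
    · rwa [one_mul]
    · simp
  have hn' : (0 : ℝ) < n := by exact_mod_cast hn
  have hT' : (0 : ℝ) < T := by exact_mod_cast hT
  -- `2 √x ≤ x / c + c`, with the `c` that is optimal when all arms are observed equally often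
  set c := √(γ * T / n) with hc
  have hc0 : 0 < c := Real.sqrt_pos.2 (by positivity)
  have hc2 : c ^ 2 = γ * T / n := Real.sq_sqrt (by positivity)
  have hpath (ω : Ω) : ∑ t ∈ Finset.range T, (if (Z t ω).observed = true then (1 : ℝ) else 0) *
        (1 / √((observedRounds (historyAt A Z t ω) (A t ω)).card + 1))
      ≤ (∑ t ∈ Finset.range T, if (Z t ω).observed = true then (1 : ℝ) else 0) / c + n * c := by
    refine (sum_observed_inv_sqrt_le A Z T ω).trans ?_
    rw [← sum_card_observedRounds, Finset.sum_div]
    have : (n : ℝ) * c = ∑ _a : Fin n, c := by simp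
    rw [this, ← Finset.sum_add_distrib]
    refine Finset.sum_le_sum fun a _ => ?_
    generalize hx : ((observedRounds (historyAt A Z T ω) a).card : ℝ) = x
    have hx0 : 0 ≤ x := hx ▸ Nat.cast_nonneg _
    rw [div_add' _ _ _ hc0.ne', le_div_iff₀ hc0]
    nlinarith [sq_nonneg (√x - c), Real.sq_sqrt hx0]
  have hint := integral_mono (integrable_finsetSum _ fun t ht => hOw ht)
    (((integrable_finsetSum _ fun t ht => hO ht).div_const c).add (integrable_const (n * c))) hpath
  rw [integral_finsetSum _ fun t ht => hOw ht, integral_add' ((integrable_finsetSum _ fun t ht =>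
    hO ht).div_const c) (integrable_const _), integral_div,
    integral_finsetSum _ fun t ht => hO ht] at hint
  have h1 : ∀ t ∈ Finset.range T,
      ∫ ω, (if (Z t ω).observed = true then (1 : ℝ) else 0) ∂P = γ := by
    intro t ht
    simpa using hr.integral_observed_mul hγ (Finset.mem_range.1 ht) (g := fun _ => 1)
      measurable_const (fun _ => zero_le_one)
  have h2 : ∀ t ∈ Finset.range T, ∫ ω, (if (Z t ω).observed = true then (1 : ℝ) else 0) *
        (1 / √((observedRounds (historyAt A Z t ω) (A t ω)).card + 1)) ∂P
      = γ * ∫ ω, 1 / √((observedRounds (historyAt A Z t ω) (A t ω)).card + 1) ∂P :=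
    fun t ht => hr.integral_observed_mul hγ (Finset.mem_range.1 ht) (measurable_inv_sqrt_card t)
      fun x => (inv_sqrt_card_mem_Icc x.1 x.2).1
  rw [Finset.sum_congr rfl h1, Finset.sum_congr rfl h2, ← Finset.mul_sum, integral_const] at hint
  simp only [Finset.sum_const, Finset.card_range, nsmul_eq_mul, probReal_univ, smul_eq_mul,
    one_mul] at hint
  have h3 : T * γ / c + n * c = γ * (2 * √(n * T / γ)) := by
    have h4 : √(n * T / γ) = n * c / γ := by
      rw [Real.sqrt_eq_iff_eq_sq (by positivity) (by positivity), div_pow, mul_pow, hc2]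
      field_simp
    rw [h4, show T * γ / c = n * c by
      rw [div_eq_iff hc0.ne', mul_assoc, ← pow_two, hc2]; field_simp]
    field_simp
    ring
  rw [h3] at hint
  exact le_of_mul_le_mul_left hint hγ0

end Expectations

/-! ### Numerical estimates -/

section Numerics

lemma nat_log_four_add_one_le {T : ℕ} (hT : 2 ≤ T) :
    (Nat.log 4 T + 1 : ℝ) ≤ 3 * Real.log T := by
  have h1 : ((4 : ℝ) ^ Nat.log 4 T) ≤ T := by exact_mod_cast Nat.pow_log_le_self 4 (by omega)
  have h2 := Real.log_le_log (by positivity) h1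
  rw [Real.log_pow, show (4 : ℝ) = 2 ^ 2 by norm_num, Real.log_pow] at h2
  have h3 : Real.log 2 ≤ Real.log T := Real.log_le_log (by norm_num) (by exact_mod_cast hT)
  push_cast at h2
  nlinarith [Real.log_two_gt_d9, (Nat.cast_nonneg _ : (0 : ℝ) ≤ (Nat.log 4 T : ℝ))]

/-- The contribution of failing confidence bounds, once the number of arms is at most `T`. -/
lemma failure_terms_le {n T : ℕ} (hT : 2 ≤ T) (hn : n ≤ T) :
    T * (Real.exp (-(3 / 4 * Real.log T)) * (Nat.log 4 T + 1)
        + n * (Real.exp (-(3 / 4 * (4 * Real.log T))) * (Nat.log 4 T + 1)))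
      ≤ 6 * √(T * Real.log T) := by
  have hJ := nat_log_four_add_one_le hT
  have hT0 : (2 : ℝ) ≤ T := by exact_mod_cast hT
  have hn' : (n : ℝ) ≤ T := by exact_mod_cast hn
  have hlog := Real.log_le_log (by norm_num) hT0
  have hexp : Real.exp (Real.log T) = T := Real.exp_log (by linarith)
  have hLT : Real.log T ≤ T := (Real.log_le_sub_one_of_pos (by linarith)).trans (by linarith)
  have hlog2 := Real.log_two_gt_d9
  set L := Real.log T
  have hL : 0 < L := by linarith
  have h1 : T * Real.exp (-(3 / 4 * L)) = Real.exp (L / 4) := by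
    rw [← hexp, ← Real.exp_add]; congr 1; ring
  have h2 : T * (T * Real.exp (-(3 / 4 * (4 * L)))) = Real.exp (-L) := by
    rw [← hexp, ← Real.exp_add, ← Real.exp_add]; congr 1; ring
  have hs : √L ≤ Real.exp (L / 4) := by
    nlinarith [Real.add_one_le_exp (L / 4), sq_nonneg (√L - 2), Real.sq_sqrt hL.le]
  have hsq : √(T * L) = Real.exp (L / 4) * Real.exp (L / 4) * √L := by
    rw [Real.sqrt_mul (by linarith), ← Real.exp_add, ← hexp, ← Real.exp_half]
    congr 2; ring
  have hA : T * (Real.exp (-(3 / 4 * L)) * (Nat.log 4 T + 1)) ≤ 3 * √(T * L) := by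
    rw [← mul_assoc, h1, hsq]
    calc Real.exp (L / 4) * (Nat.log 4 T + 1) ≤ Real.exp (L / 4) * (3 * (√L * √L)) := by
          rw [Real.mul_self_sqrt hL.le]; gcongr
      _ ≤ Real.exp (L / 4) * (3 * (Real.exp (L / 4) * √L)) := by gcongr
      _ = _ := by ring
  have hB : T * (n * (Real.exp (-(3 / 4 * (4 * L))) * (Nat.log 4 T + 1))) ≤ 3 * √(T * L) := by
    calc T * (n * (Real.exp (-(3 / 4 * (4 * L))) * (Nat.log 4 T + 1)))
        ≤ T * (T * (Real.exp (-(3 / 4 * (4 * L))) * (3 * T))) := by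
          gcongr; linarith
      _ = T * (T * Real.exp (-(3 / 4 * (4 * L)))) * (3 * T) := by ring
      _ = 3 := by rw [h2, Real.exp_neg, hexp]; field_simp
      _ ≤ 3 * √(T * L) := by
          have : 1 ≤ √(T * L) := Real.one_le_sqrt.2 (by nlinarith)
          linarith
  linarith

end Numerics

end MissingBandit

/-! ### The regret bound -/

open MissingBandit in
theorem mainTheorem1 :
    ∃ C : ℝ, 0 < C ∧
      ∀ (n : ℕ) (𝓜 : Type*) [Countable 𝓜] [MeasurableSpace 𝓜] [MeasurableSingletonClass 𝓜]
        (ν : Kernel (Fin n) (Draw 𝓜)) [IsMarkovKernel ν] (γ : ℝ),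
        (∀ a, (ν a).real {z | z.observed = true} = γ) →
        IsMCAR ν →
        Positivity ν →
        (∀ a, armMean ν a ∈ Set.Icc (0 : ℝ) 1) →
        (∀ a, HasSubgaussianMGF (fun z : Draw 𝓜 => z.reward - armMean ν a) (1 / 4) (ν a)) →
        ∀ (α : ℝ), 1 < α → ∀ (T : ℕ), 2 ≤ T →
        ∀ (Ω : Type*) [MeasurableSpace Ω] (P : Measure Ω) [IsProbabilityMeasure P]
          (A : ℕ → Ω → Fin n) (Z : ℕ → Ω → Draw 𝓜),
          IsUCBRun ν α T P A Z →
          Integrable (cumulativeRegret ν A T) P ∧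
            ∫ ω, cumulativeRegret ν A T ω ∂P ≤ C * √(α * n * T * Real.log T / γ) := by
  -- `12 = 6 + 6`, for the confidence radii and for the failures of the confidence bounds
  refine ⟨12, by norm_num, ?_⟩
  intro n 𝓜 _ _ _ ν _ γ hγ hmcar hpos hmean hsg α hα T hT Ω _ P _ A Z hr
  obtain ⟨ω₀⟩ : Nonempty Ω := P.nonempty_of_neZero
  have : Nonempty (Fin n) := ⟨A 0 ω₀⟩
  have hn : 0 < n := Fin.pos (A 0 ω₀)
  obtain ⟨a, ha⟩ : ∃ a, armMean ν a = bestMean ν := exists_eq_ciSup_of_finite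
  have hle (b : Fin n) : armMean ν b ≤ bestMean ν := le_ciSup (Set.finite_range _).bddAbove b
  have hΔ (b : Fin n) : bestMean ν - armMean ν b ∈ Set.Icc (0 : ℝ) 1 :=
    ⟨by linarith [hle b], by rw [← ha]; linarith [(hmean a).2, (hmean b).1]⟩
  have hγ0 : 0 < γ := by
    rw [← hγ a]
    exact ENNReal.toReal_pos (hpos.observed_ne_zero a) (measure_ne_top _ _)
  have hγ1 : γ ≤ 1 := hγ a ▸ measureReal_le_one
  obtain ⟨hL2, hLα⟩ := log_two_le_mul_log hα hT
  have hlog2 := Real.log_two_gt_d9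
  have hL : 0 < Real.log T := by linarith
  have hn' : (1 : ℝ) ≤ n := by exact_mod_cast hn
  have hT' : (2 : ℝ) ≤ T := by exact_mod_cast hT
  have hint {t : ℕ} (ht : t ∈ Finset.range T) :
      Integrable (fun ω => bestMean ν - armMean ν (A t ω)) P :=
    integrable_of_mem_Icc ((measurable_of_finite fun b => bestMean ν - armMean ν b).comp_aemeasurable
      (hr.aemeasurable_arm (Finset.mem_range.1 ht))) fun ω => hΔ _
  refine ⟨integrable_finsetSum _ fun t ht => hint ht, ?_⟩
  have hγdiv {x : ℝ} (hx : 0 ≤ x) : x ≤ x / γ := le_div_self hx hγ0 hγ1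
  unfold cumulativeRegret
  rw [integral_finsetSum _ fun t ht => hint ht]
  rcases lt_or_ge T n with hTn | hTn
  -- with more arms than rounds, `T ≤ √(n T)` bounds the regret
  · have hTn' : (T : ℝ) ≤ n := by exact_mod_cast hTn.le
    calc _ ≤ ∑ t ∈ Finset.range T, (1 : ℝ) := Finset.sum_le_sum fun t ht => by
            simpa using integral_mono (hint ht) (integrable_const (1 : ℝ)) fun ω => (hΔ (A t ω)).2
      _ = T := by simp
      _ ≤ 12 * √(α * n * T * Real.log T / γ) := by
          have : (T : ℝ) / 12 ≤ √(α * n * T * Real.log T / γ) := by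
            refine Real.le_sqrt_of_sq_le (le_trans ?_ (hγdiv (by positivity)))
            have h1 : (T : ℝ) * T ≤ n * T := by gcongr
            have h2 : n * T * (1 / 2) ≤ n * T * (α * Real.log T) := by gcongr; linarith
            nlinarith
          linarith
  · have hround : ∀ t ∈ Finset.range T, ∫ ω, bestMean ν - armMean ν (A t ω) ∂P
        ≤ 3 * √(α * Real.log T) *
            ∫ ω, 1 / √((observedRounds (historyAt A Z t ω) (A t ω)).card + 1) ∂P
          + (Real.exp (-(3 / 4 * Real.log T)) * (Nat.log 4 T + 1)
            + n * (Real.exp (-(3 / 4 * (4 * Real.log T))) * (Nat.log 4 T + 1))) := by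
      intro t ht
      have ht' := Finset.mem_range.1 ht
      have hi1 := (hr.integrable_inv_sqrt_card ht').const_mul (3 * √(α * Real.log T))
      have hi2 := hr.integrable_tailMixture hmcar (hsg a) (-1) (Real.log T) ht'
      have hi3 := integrable_finsetSum Finset.univ fun c _ =>
        hr.integrable_tailMixture hmcar (hsg c) 1 (4 * Real.log T) ht'
      refine (integral_mono_ae (hint ht) ((hi1.add hi2).add hi3) ?_).trans ?_
      · filter_upwards [hr.select t ht'] with ω hω
        rw [← ha]
        exact sub_le_of_ucbIndex_le hα hT ht'.le hmean (hω a)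
      · rw [integral_add' (hi1.add hi2) hi3, integral_add' hi1 hi2, integral_const_mul,
          integral_finsetSum _ fun c _ =>
            hr.integrable_tailMixture hmcar (hsg c) 1 (4 * Real.log T) ht', add_assoc]
        gcongr
        · exact hr.integral_tailMixture_le hmcar (hsg a) _ _ ht'
        · refine (Finset.sum_le_sum fun c _ =>
            hr.integral_tailMixture_le hmcar (hsg c) _ _ ht').trans_eq ?_
          simp
    refine (Finset.sum_le_sum hround).trans ?_
    rw [Finset.sum_add_distrib, ← Finset.mul_sum, Finset.sum_const, Finset.card_range,
      nsmul_eq_mul]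
    have h1 : 3 * √(α * Real.log T) * (2 * √(n * T / γ))
        = 6 * √(α * n * T * Real.log T / γ) := by
      rw [show α * n * T * Real.log T / γ = α * Real.log T * (n * T / γ) by ring,
        Real.sqrt_mul (x := α * Real.log T) (by linarith)]
      ring
    have h2 : √(T * Real.log T) ≤ √(α * n * T * Real.log T / γ) := by
      refine Real.sqrt_le_sqrt (le_trans ?_ (hγdiv (by positivity)))
      have : 1 ≤ α * n := one_le_mul_of_one_le_of_one_le hα.le hn'
      rw [mul_assoc (α * n)]
      exact le_mul_of_one_le_left (by positivity) this
    have h3 := mul_le_mul_of_nonneg_left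
      (hr.sum_integral_inv_sqrt_card_le hγ0 hγ hn (by omega))
      (by positivity : 0 ≤ 3 * √(α * Real.log T))
    linarith [failure_terms_le hT hTn]
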